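/- Let $f:\mathbb R\to\mathbb R$ be given by $f(x)=x$ for $x\le 0$ and $f(x)=x+1$ for $x>0$. There is a set $X\subseteq\mathbb R$, dense in $\mathbb R$ and of cardinality $2^{\aleph_0}$, such that: 1. the only surjective map $X\to X$ preserving $\le$ is the identity ($X$ is epimorphism-rigid); 2. $f$ maps $X$ into $X$, and its restriction to $X$ is an order-embedding of $X$ other than the identity; 3. every order-embedding $g$ of $X$ into itself other than the identity is generated from $f$ in the wide sense. Here $g:X\to X$ is *generated from $f$ in the wide sense* if there are real numbers $b_0<b_1<b_2<\cdots$ (not necessarily in $X$), integers $1\le k_0\le k_1\le k_2\le\cdots$ and real numbers $h(0),h(1),\dots$ such that - for every $a\in(b_0,b_1)$ we have $a<f(a)$ and $b_i<\sup_m f^m(a)$ for all $i$; - $\sup_i f^{k_i}(b_i)=\sup_i b_i$ (suprema in $[-\infty,\infty]$); - $b_0\le h(0)\le f^{k_0}(b_0)$, and $f^{k_i}(b_{i+1})\le h(i+1)\le f^{k_{i+1}}(b_{i+1})$ for all $i\ge 0$; - for $x\in X$: $g(x)=x$ if $x\notin\bigcup_i[b_i,b_{i+1}]$; $g(x)=f^{k_i}(x)$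 if $b_i<x<b_{i+1}$; and $g(x)=h(i)$ if $x=b_i$. -/

import Mathlib

/-- A chain is epimorphism-rigid if its only epimorphism (surjective map preserving `≤`)
is the identity. -/
def EpimorphismRigid (α : Type*) [LinearOrder α] : Prop :=
  ∀ e : α →o α, Function.Surjective e → ∀ x, e x = x

/-- The embedding of `ℝ` that is the identity for `x ≤ 0` and `x ↦ x + 1` for `x > 0`. -/
noncomputable def shiftPos (x : ℝ) : ℝ := if x ≤ 0 then x else x + 1

/-- For an embedding `f` of `ℝ` and a subchain `X` of `ℝ`, the self-map `g` of `X` is generated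
from `f` in the wide sense (along a stretch on which `f` moves points upwards; `shiftPos` moves no
point downwards). The cut points `b i` are real numbers and need not belong to `X`.

The second clause says that for each point `a` just to the right of `b 0` the whole sequence lies
below the supremum of the orbit `a < f a < f (f a) < …`; the point `b 0` itself may be fixed by
`f`, as it is when `f = shiftPos` and `b 0 = 0`. Suprema are taken in the extended reals. -/
def GeneratedInWideSense (f : ℝ → ℝ) {X : Set ℝ} (g : X → X) : Prop :=
  ∃ (b : ℕ → ℝ) (k : ℕ → ℕ) (h : ℕ → ℝ),
    StrictMono b ∧
    (∀ a ∈ Set.Ioo (b 0) (b 1), a < f a ∧ ∀ i, ∃ m : ℕ, b i < f^[m] a) ∧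
    1 ≤ k 0 ∧ Monotone k ∧
    (⨆ i, ((f^[k i] (b i) : ℝ) : EReal)) = ⨆ i, ((b i : ℝ) : EReal) ∧
    (b 0 ≤ h 0 ∧ h 0 ≤ f^[k 0] (b 0)) ∧
    (∀ i, f^[k i] (b (i + 1)) ≤ h (i + 1) ∧ h (i + 1) ≤ f^[k (i + 1)] (b (i + 1))) ∧
    (∀ x : X, (x : ℝ) ∉ ⋃ i, Set.Icc (b i) (b (i + 1)) → g x = x) ∧
    (∀ (i : ℕ) (x : X), (x : ℝ) ∈ Set.Ioo (b i) (b (i + 1)) → (g x : ℝ) = f^[k i] x) ∧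
    (∀ (i : ℕ) (x : X), (x : ℝ) = b i → (g x : ℝ) = h i)

open Set Filter Topology Cardinal

/-! Call `φ x - x` the displacement of `φ`. Off a countable set, a monotone `φ : ℝ → ℝ` is
determined by its values on `ℚ`, so `𝔠` codes suffice. A recursion of length `𝔠` treats each code:
if `φ` has `𝔠` many values at continuity points that it moves off their forward `shiftPos`-orbits,
some such `x` enters `X` together with its orbit, and `φ x` is kept out for good
(`exists_diagonal_set`, `exists_shiftPos_diagonal_set`). So monotone self-maps of `X`, extended to
`ℝ`, can leave orbits only with few values.

An epimorphism extends to a continuous `φ`, which must be constant on intervals of off-orbit points.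
This makes the displacement antitone (`antitone_sub`), and a nonzero displacement would then make
`φ` constant on a half-line, against surjectivity.

An embedding extends to a strictly increasing `φ`, which at nonzero continuity points stays on
orbits: the displacement is `0` on the negatives and a natural number on the positives, where
injectivity makes it nondecreasing (`monotoneOn_sub_of_dense`). Its stretches of constancy give the
`b i` and `k i`. -/

/-! ### Transfinite diagonalisation. -/

theorem exists_wellFounded_choice {κ : Type*} [LT κ] [WellFoundedLT κ] {β : Type*}
    (Q : ∀ i : κ, (∀ j, j < i → β) → β → Prop) (hQ : ∀ i prev, ∃ q, Q i prev q) :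
    ∃ p : κ → β, ∀ i, Q i (fun j _ => p j) (p i) := by
  choose F hF using hQ
  refine ⟨(wellFounded_lt (α := κ)).fix F, fun i => ?_⟩
  rw [WellFounded.fix_eq]
  exact hF _ _

/-- Diagonalisation: given at most `𝔠` sets of pairs, none of which is exhausted by removing fewer
than `𝔠` points, there is a set of size `𝔠`, closed under an injective map `f`, that separates some
pair of each set. -/
theorem exists_diagonal_set {α : Type} {f : α → α} (hf : Function.Injective f) {ι : Type}
    (hι : #ι = 𝔠) (P : ι → Set (α × α))
    (horb : ∀ i, ∀ p ∈ P i, ∀ n : ℕ, f^[n] p.1 ≠ p.2)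
    (hP : ∀ i, ∀ B : Set α, #B < 𝔠 → ∃ p ∈ P i, p.1 ∉ B ∧ p.2 ∉ B)
    {X₀ E₀ : Set α} (hX₀ : X₀.Countable) (hE₀ : E₀.Countable) (hXf : MapsTo f X₀ X₀)
    (hEf : ∀ x, f x ∈ E₀ → x ∈ E₀) (hXE : Disjoint X₀ E₀) :
    ∃ X : Set α, X₀ ⊆ X ∧ Disjoint X E₀ ∧ MapsTo f X X ∧ 𝔠 ≤ #X ∧
      ∀ i, ∃ p ∈ P i, p.1 ∈ X ∧ p.2 ∉ X := by
  classical
  let κ := (Cardinal.ord 𝔠).ToType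
  have hκ : #κ = 𝔠 := by simp [κ]
  obtain ⟨e⟩ : Nonempty (κ ≃ ι) := Cardinal.eq.1 (hκ.trans hι.symm)
  -- Later pairs must avoid the forward orbit of `p.1`, which lies in `X`, and every point whose
  -- orbit would reach the excluded `p.2`.
  let R : α × α → Set α := fun p =>
    (range fun n : ℕ => f^[n] p.1) ∪ ⋃ n : ℕ, f^[n] ⁻¹' {p.2}
  have hR : ∀ p, (R p).Countable := fun p => by
    refine (countable_range _).union (countable_iUnion fun n => ?_)
    exact (countable_singleton _).preimage_of_injOn (hf.iterate n).injOn
  obtain ⟨p, hp⟩ := exists_wellFounded_choice (κ := κ) (β := α × α)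
    (fun i prev q => q ∈ P (e i) ∧
      q.1 ∉ (X₀ ∪ E₀) ∪ (⋃ j : Iio i, R (prev j j.2)) ∧
      q.2 ∉ (X₀ ∪ E₀) ∪ (⋃ j : Iio i, R (prev j j.2))) (fun i prev => by
    refine hP (e i) _ ?_
    have h1 : #(Iio i) < 𝔠 := by
      have := Cardinal.mk_Iio_lt i (by rw [hκ, Ordinal.type_toType])
      rwa [hκ] at this
    refine (mk_union_le _ _).trans_lt (add_lt_of_lt aleph0_le_continuum ?_ ?_)
    · exact ((hX₀.union hE₀).le_aleph0).trans_lt aleph0_lt_continuum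
    · refine (mk_iUnion_le _).trans_lt ?_
      have h2 : ⨆ j : Iio i, #(R (prev j j.2)) ≤ ℵ₀ := ciSup_le' fun j => (hR _).le_aleph0
      exact (mul_le_mul_right h2 _).trans_lt
        (mul_lt_of_lt aleph0_le_continuum h1 aleph0_lt_continuum))
  have hlt : ∀ i j, j < i → (p i).1 ∉ R (p j) ∧ (p i).2 ∉ R (p j) := fun i j hij =>
    ⟨fun h => (hp i).2.1 (Or.inr (mem_iUnion.2 ⟨⟨j, hij⟩, h⟩)),
     fun h => (hp i).2.2 (Or.inr (mem_iUnion.2 ⟨⟨j, hij⟩, h⟩))⟩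
  have hEn : ∀ (n : ℕ) x, f^[n] x ∈ E₀ → x ∈ E₀ := by
    intro n
    induction n with
    | zero => intro x h; simpa using h
    | succ n ih => intro x h; exact hEf x (ih _ (by simpa using h))
  refine ⟨X₀ ∪ ⋃ i : κ, range fun n : ℕ => f^[n] (p i).1, subset_union_left, ?_, ?_, ?_, ?_⟩
  · rw [disjoint_union_left]
    refine ⟨hXE, ?_⟩
    rw [Set.disjoint_left]
    intro x hx hxE
    obtain ⟨i, n, rfl⟩ := mem_iUnion.1 hx
    exact (hp i).2.1 (Or.inl (Or.inr (hEn n _ hxE)))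
  · rintro x (hx | hx)
    · exact Or.inl (hXf hx)
    · obtain ⟨i, n, rfl⟩ := mem_iUnion.1 hx
      exact Or.inr (mem_iUnion.2 ⟨i, n + 1, Function.iterate_succ_apply' f n _⟩)
  · have hinj : Function.Injective fun i : κ => (p i).1 := by
      have key : ∀ i j, j < i → (p i).1 ≠ (p j).1 := fun i j hij h =>
        (hlt i j hij).1 (Or.inl ⟨0, h.symm⟩)
      intro i j h
      rcases lt_trichotomy i j with hij | hij | hij
      · exact absurd h.symm (key j i hij)
      · exact hij
      · exact absurd h (key i j hij)
    rw [← hκ]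
    refine mk_le_of_injective (f := fun i : κ => (⟨(p i).1, Or.inr (mem_iUnion.2 ⟨i, 0, rfl⟩)⟩ : ↥(X₀ ∪ ⋃ i : κ, range fun n : ℕ => f^[n] (p i).1))) ?_
    intro i j h
    exact hinj (congrArg Subtype.val h)
  · intro k
    obtain ⟨i, rfl⟩ := e.surjective k
    refine ⟨p i, (hp i).1, Or.inr (mem_iUnion.2 ⟨i, 0, rfl⟩), ?_⟩
    rintro (h | h)
    · exact (hp i).2.2 (Or.inl (Or.inl h))
    · obtain ⟨j, n, h⟩ := mem_iUnion.1 h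
      rcases lt_trichotomy i j with hij | rfl | hij
      · exact (hlt j i hij).1 (Or.inr (mem_iUnion.2 ⟨n, h⟩))
      · exact horb _ _ (hp i).1 n h
      · exact (hlt i j hij).2 (Or.inl ⟨n, h⟩)

/-! ### Iterates of `shiftPos` and the construction of `X`. -/

theorem shiftPos_of_nonpos {x : ℝ} (hx : x ≤ 0) : shiftPos x = x := if_pos hx

theorem shiftPos_of_pos {x : ℝ} (hx : 0 < x) : shiftPos x = x + 1 := if_neg hx.not_ge

theorem shiftPos_strictMono : StrictMono shiftPos := by
  intro x y h
  unfold shiftPos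
  split_ifs <;> linarith

theorem shiftPos_iterate_of_nonpos {x : ℝ} (hx : x ≤ 0) (n : ℕ) : shiftPos^[n] x = x :=
  Function.iterate_fixed (shiftPos_of_nonpos hx) n

theorem shiftPos_iterate_of_pos {x : ℝ} (hx : 0 < x) (n : ℕ) : shiftPos^[n] x = x + n := by
  induction n with
  | zero => simp
  | succ n ih =>
    rw [Function.iterate_succ_apply', ih, shiftPos_of_pos (by positivity)]
    push_cast; ring

/-- A monotone map is determined at its continuity points by its values on the rationals. -/
theorem Monotone.eq_of_eqOn_rat {φ φ' : ℝ → ℝ} (h' : Monotone φ')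
    (he : ∀ q : ℚ, φ' q = φ q) {x : ℝ} (hx : ContinuousAt φ x) : φ' x = φ x := by
  refine le_antisymm (le_of_forall_gt_imp_ge_of_dense fun c hc => ?_)
    (le_of_forall_lt_imp_le_of_dense fun c hc => ?_)
  · obtain ⟨u, hu, hu'⟩ := exists_Ico_subset_of_mem_nhds (hx.eventually (gt_mem_nhds hc)) ⟨x + 1, by simp⟩
    obtain ⟨q, hq1, hq2⟩ := exists_rat_btwn hu
    calc φ' x ≤ φ' q := h' hq1.le
      _ = φ q := he q
      _ ≤ c := (hu' ⟨hq1.le, hq2⟩ : φ q < c).le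
  · obtain ⟨u, hu, hu'⟩ := exists_Ioc_subset_of_mem_nhds (hx.eventually (lt_mem_nhds hc)) ⟨x - 1, by simp⟩
    obtain ⟨q, hq1, hq2⟩ := exists_rat_btwn hu
    calc c ≤ φ q := (hu' ⟨hq1, hq2.le⟩ : c < φ q).le
      _ = φ' q := (he q).symm
      _ ≤ φ' x := h' hq2.le

/-- The points that `φ` does not move along their forward orbit under `shiftPos`. -/
def offOrbit (φ : ℝ → ℝ) : Set ℝ := {x | ∀ n : ℕ, shiftPos^[n] x ≠ φ x}

theorem exists_shiftPos_diagonal_set : ∃ X : Set ℝ, Dense X ∧ (0 : ℝ) ∉ X ∧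
    MapsTo shiftPos X X ∧ #X = 𝔠 ∧ ∀ φ : ℝ → ℝ, Monotone φ →
      𝔠 ≤ #(φ '' {x ∈ offOrbit φ | ContinuousAt φ x}) → ∃ x ∈ X, φ x ∉ X := by
  classical
  -- `r` codes a monotone map by its values on `ℚ`; only pairs on which all maps with this code
  -- agree are kept.
  let G : (ℚ → ℝ) → Set (ℝ × ℝ) := fun r => {p | (∀ n : ℕ, shiftPos^[n] p.1 ≠ p.2) ∧
    ∀ φ : ℝ → ℝ, Monotone φ → (∀ q : ℚ, φ q = r q) → φ p.1 = p.2}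
  let T : Set (ℝ × ℝ) := {p | ∀ n : ℕ, shiftPos^[n] p.1 ≠ p.2}
  have hT : ∀ B : Set ℝ, #B < 𝔠 → ∃ p ∈ T, p.1 ∉ B ∧ p.2 ∉ B := by
    intro B hB
    have : #(((fun x : ℝ => x - 1) ⁻¹' B ∪ B : Set ℝ)) < 𝔠 := by
      refine (mk_union_le _ _).trans_lt (add_lt_of_lt aleph0_le_continuum ?_ hB)
      exact (mk_preimage_of_injective _ _ (sub_left_injective)).trans_lt hB
    obtain ⟨x, hx⟩ : ∃ x, x ∉ ((fun x : ℝ => x - 1) ⁻¹' B ∪ B : Set ℝ) := by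
      by_contra! h
      rw [eq_univ_of_forall h, mk_univ, mk_real] at this
      exact this.false
    refine ⟨(x, x - 1), fun n => ?_, fun h => hx (Or.inr h), fun h => hx (Or.inl h)⟩
    rcases le_or_gt x 0 with h | h
    · simp only [shiftPos_iterate_of_nonpos h]; linarith
    · simp only [shiftPos_iterate_of_pos h]
      have : (0 : ℝ) ≤ n := by positivity
      linarith
  -- Codes that the diagonalisation cannot treat get the harmless `T`, so that its hypotheses hold
  -- for every code.
  let P : (ℚ → ℝ) → Set (ℝ × ℝ) := fun r =>
    if ∀ B : Set ℝ, #B < 𝔠 → ∃ p ∈ G r, p.1 ∉ B ∧ p.2 ∉ B then G r else T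
  obtain ⟨X, hX0, hXE, hXf, hXc, hXP⟩ := exists_diagonal_set (ι := ℚ → ℝ)
    shiftPos_strictMono.injective (by simp [mk_real]) P (by
      intro r p hp
      by_cases h : ∀ B : Set ℝ, #B < 𝔠 → ∃ p ∈ G r, p.1 ∉ B ∧ p.2 ∉ B
      · simp only [P, if_pos h] at hp
        exact hp.1
      · simp only [P, if_neg h] at hp
        exact hp) (by
      intro r
      by_cases h : ∀ B : Set ℝ, #B < 𝔠 → ∃ p ∈ G r, p.1 ∉ B ∧ p.2 ∉ B
      · simpa only [P, if_pos h] using h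
      · simpa only [P, if_neg h] using hT)
    -- The nonzero rationals give density. The point `0` is kept out because embeddings may jump
    -- there.
    (X₀ := range ((↑) : ℚ → ℝ) \ {0}) (E₀ := {0})
    ((countable_range _).mono sdiff_subset) (countable_singleton _) (by
      rintro _ ⟨⟨q, rfl⟩, hq⟩
      rcases le_or_gt (q : ℝ) 0 with h | h
      · rw [shiftPos_of_nonpos h]; exact ⟨⟨q, rfl⟩, hq⟩
      · rw [shiftPos_of_pos h]
        exact ⟨⟨q + 1, by push_cast; ring⟩, by simp only [mem_singleton_iff]; linarith⟩) (by
      intro x hx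
      rcases le_or_gt x 0 with h | h
      · rwa [shiftPos_of_nonpos h] at hx
      · rw [shiftPos_of_pos h, mem_singleton_iff] at hx
        linarith) disjoint_sdiff_left
  refine ⟨X, (Rat.denseRange_cast.sdiff_singleton 0).mono hX0,
    fun h => disjoint_left.1 hXE h rfl, hXf, le_antisymm ?_ hXc, fun φ hφ hc => ?_⟩
  · exact (mk_set_le X).trans mk_real.le
  · have hG : ∀ B : Set ℝ, #B < 𝔠 → ∃ p ∈ G (fun q => φ q), p.1 ∉ B ∧ p.2 ∉ B := by
      intro B hB
      -- A value outside `φ '' B` can only come from a point outside `B`.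
      have : #(φ '' B ∪ B : Set ℝ) < 𝔠 :=
        (mk_union_le _ _).trans_lt
          (add_lt_of_lt aleph0_le_continuum (mk_image_le.trans_lt hB) hB)
      obtain ⟨_, ⟨x, ⟨hx, hxc⟩, rfl⟩, hy⟩ := not_subset.1
        fun h => (this.trans_le hc).not_ge (mk_le_mk_of_subset h)
      exact ⟨(x, φ x), ⟨hx, fun φ' hφ' he => hφ'.eq_of_eqOn_rat he hxc⟩,
        fun h => hy (Or.inl ⟨x, h, rfl⟩), fun h => hy (Or.inr h)⟩
    obtain ⟨p, hp, h1, h2⟩ := hXP fun q => φ q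
    simp only [P, if_pos hG] at hp
    exact ⟨p.1, h1, by rwa [hp.2 φ hφ fun _ => rfl]⟩

/-! ### Extension of self-maps of `X` to `ℝ`. -/

theorem Dense.exists_monotone_extension_real {X : Set ℝ} (hX : Dense X) {e : X → X}
    (he : Monotone e) : ∃ φ : ℝ → ℝ, Monotone φ ∧ ∀ x : X, φ x = e x := by
  let S : ℝ → Set ℝ := fun x => {y | ∃ z : X, (z : ℝ) ≤ x ∧ y = e z}
  have hb : ∀ x, BddAbove (S x) := fun x => by
    obtain ⟨w, hw, hxw⟩ := hX.exists_gt x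
    refine ⟨e ⟨w, hw⟩, ?_⟩
    rintro _ ⟨z, hz, rfl⟩
    exact he (hz.trans hxw.le)
  have hne : ∀ x, (S x).Nonempty := fun x => by
    obtain ⟨w, hw, hxw⟩ := hX.exists_lt x
    exact ⟨_, ⟨w, hw⟩, hxw.le, rfl⟩
  refine ⟨fun x => sSup (S x), fun x y h => ?_, fun x => ?_⟩
  · refine csSup_le_csSup (hb y) (hne x) ?_
    rintro _ ⟨z, hz, rfl⟩
    exact ⟨z, hz.trans h, rfl⟩
  · refine le_antisymm (csSup_le (hne _) ?_) (le_csSup (hb _) ⟨x, le_rfl, rfl⟩)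
    rintro _ ⟨z, hz, rfl⟩
    exact he hz

theorem Dense.strictMono_extension {X : Set ℝ} (hX : Dense X) {e : X → X}
    (he : StrictMono e) {φ : ℝ → ℝ} (hφ : Monotone φ) (hφe : ∀ x : X, φ x = e x) :
    StrictMono φ := by
  intro x y h
  obtain ⟨u, hu, hxu, huy⟩ := hX.exists_between h
  obtain ⟨v, hv, huv, hvy⟩ := hX.exists_between huy
  calc φ x ≤ φ u := hφ hxu.le
    _ = e ⟨u, hu⟩ := hφe ⟨u, hu⟩
    _ < e ⟨v, hv⟩ := he huv
    _ = φ v := (hφe ⟨v, hv⟩).symm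
    _ ≤ φ y := hφ hvy.le

/-! ### Off-orbit points and epimorphism-rigidity. -/

theorem mem_offOrbit_of_nonpos {φ : ℝ → ℝ} {x : ℝ} (hx : x ≤ 0) :
    x ∈ offOrbit φ ↔ φ x ≠ x := by
  simp [offOrbit, shiftPos_iterate_of_nonpos hx, eq_comm]

theorem mem_offOrbit_of_pos {φ : ℝ → ℝ} {x : ℝ} (hx : 0 < x) :
    x ∈ offOrbit φ ↔ φ x - x ∉ range ((↑) : ℕ → ℝ) := by
  simp [offOrbit, shiftPos_iterate_of_pos hx, eq_sub_iff_add_eq, add_comm]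

theorem mem_offOrbit_of_sub_notMem_int {φ : ℝ → ℝ} {x : ℝ}
    (hx : φ x - x ∉ range ((↑) : ℤ → ℝ)) : x ∈ offOrbit φ := by
  rcases le_or_gt x 0 with h | h
  · rw [mem_offOrbit_of_nonpos h]
    intro h'
    exact hx ⟨0, by simp [h']⟩
  · rw [mem_offOrbit_of_pos h]
    rintro ⟨n, hn⟩
    exact hx ⟨n, by simp [← hn]⟩

/-- Leaving the orbit means that the displacement avoids a closed set, `{0}` on the left of `0` and
`ℕ` on the right; at `0` itself the rule changes. -/
theorem offOrbit_mem_nhds {φ : ℝ → ℝ} {x : ℝ} (hx : ContinuousAt φ x) (h0 : x ≠ 0)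
    (h : x ∈ offOrbit φ) : offOrbit φ ∈ 𝓝 x := by
  have hc : ContinuousAt (fun y => φ y - y) x := hx.sub continuousAt_id
  rcases lt_or_gt_of_ne h0 with h0 | h0
  · rw [mem_offOrbit_of_nonpos h0.le] at h
    filter_upwards [hc.eventually_ne (sub_ne_zero.2 h), gt_mem_nhds h0] with y hy hy0
    rw [mem_offOrbit_of_nonpos hy0.le]
    exact sub_ne_zero.1 hy
  · rw [mem_offOrbit_of_pos h0] at h
    filter_upwards [hc.eventually
      (Nat.isClosedEmbedding_coe_real.isClosed_range.isOpen_compl.mem_nhds h),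
      lt_mem_nhds h0] with y hy hy0
    rw [mem_offOrbit_of_pos hy0]
    exact hy

/-- `X` is not preserved by any monotone map that moves too many points off their orbits. -/
def SeparatesShiftPos (X : Set ℝ) : Prop := ∀ φ : ℝ → ℝ, Monotone φ →
  𝔠 ≤ #(φ '' {x ∈ offOrbit φ | ContinuousAt φ x}) → ∃ x ∈ X, φ x ∉ X

/-- Otherwise a whole interval is off-orbit; discarding its countably many discontinuities leaves
`𝔠` points, with distinct images by injectivity. -/
theorem SeparatesShiftPos.notMem_offOrbit {X : Set ℝ} (hX : SeparatesShiftPos X) {φ : ℝ → ℝ}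
    (hφ : StrictMono φ) (hφX : MapsTo φ X X) {x : ℝ} (hx : ContinuousAt φ x) (h0 : x ≠ 0) :
    x ∉ offOrbit φ := by
  intro h
  obtain ⟨a, b, hab, hU⟩ := mem_nhds_iff_exists_Ioo_subset.1 (offOrbit_mem_nhds hx h0 h)
  obtain ⟨y, hy, hy'⟩ := hX φ hφ.monotone (by
    rw [mk_image_eq hφ.injective]
    have h1 : #{x | ¬ ContinuousAt φ x} < 𝔠 :=
      hφ.monotone.countable_not_continuousAt.le_aleph0.trans_lt aleph0_lt_continuum
    have h2 : 𝔠 ≤ #{x ∈ offOrbit φ | ContinuousAt φ x} + #{x | ¬ ContinuousAt φ x} := by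
      rw [← mk_Ioo_real (hab.1.trans hab.2)]
      refine (mk_le_mk_of_subset ?_).trans (mk_union_le _ _)
      intro y hy
      by_cases hc : ContinuousAt φ y
      · exact Or.inl ⟨hU hy, hc⟩
      · exact Or.inr hc
    by_contra! h3
    exact (add_lt_of_lt aleph0_le_continuum h3 h1).not_ge h2)
  exact hy' (hφX hy)

/-- The image is an interval, and two distinct values would give `𝔠` of them. -/
theorem SeparatesShiftPos.image_subsingleton {X : Set ℝ} (hX : SeparatesShiftPos X) {φ : ℝ → ℝ}
    (hφ : Monotone φ) (hc : Continuous φ) (hφX : MapsTo φ X X) {U : Set ℝ}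
    (hU : IsPreconnected U) (h : U ⊆ offOrbit φ) : (φ '' U).Subsingleton := by
  have hI := (hU.image φ hc.continuousOn).ordConnected
  by_contra hn
  rw [not_subsingleton_iff] at hn
  obtain ⟨u, hu, v, hv, huv⟩ := hn.exists_lt
  obtain ⟨y, hy, hy'⟩ := hX φ hφ (by
    rw [← mk_Ioo_real huv]
    refine mk_le_mk_of_subset ((Ioo_subset_Icc_self.trans (hI.out hu hv)).trans ?_)
    exact image_mono fun x hx => ⟨h hx, hc.continuousAt⟩)
  exact hy' (hφX hy)

/-- If the displacement rose, it would cross a non-integer `v`. At the last crossing `z` it is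
non-integral nearby, so `φ` is locally constant and the displacement falls just to the right of `z`,
where it should exceed `v`. -/
theorem SeparatesShiftPos.antitone_sub {X : Set ℝ} (hX : SeparatesShiftPos X) {φ : ℝ → ℝ}
    (hφ : Monotone φ) (hc : Continuous φ) (hφX : MapsTo φ X X) :
    Antitone fun x => φ x - x := by
  intro y x hyx
  by_contra! hlt
  obtain ⟨v, ⟨hv1, hv2⟩, hv⟩ : ∃ v ∈ Ioo (φ y - y) (φ x - x), v ∉ range ((↑) : ℤ → ℝ) := by
    by_contra! h
    have := mk_le_mk_of_subset (s := Ioo (φ y - y) (φ x - x)) (t := range ((↑) : ℤ → ℝ)) h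
    rw [mk_Ioo_real hlt] at this
    exact (this.trans (countable_range _).le_aleph0).not_gt aleph0_lt_continuum
  have hcψ : Continuous fun z => φ z - z := hc.sub continuous_id
  let S : Set ℝ := Icc y x ∩ {z | φ z - z ≤ v}
  have hS : IsCompact S := isCompact_Icc.inter_right (isClosed_le hcψ continuous_const)
  obtain ⟨z, ⟨⟨hyz, hzx⟩, hzv⟩, hz⟩ := hS.exists_isGreatest ⟨y, ⟨le_rfl, hyx⟩, hv1.le⟩
  simp only [mem_ofPred_eq] at hzv
  have hzx' : z < x := hzx.lt_of_ne (by rintro rfl; linarith)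
  have hgt : ∀ w ∈ Ioc z x, v < φ w - w := fun w hw => by
    by_contra! h
    exact (hz ⟨⟨hyz.trans hw.1.le, hw.2⟩, h⟩).not_gt hw.1
  have hzv' : φ z - z = v := by
    refine le_antisymm hzv (ge_of_tendsto (hcψ.continuousWithinAt (s := Ioi z) (x := z)) ?_)
    filter_upwards [Ioc_mem_nhdsGT hzx'] with w hw using (hgt w hw).le
  have hmem : {w | φ w - w ∉ range ((↑) : ℤ → ℝ)} ∈ 𝓝 z :=
    hcψ.continuousAt.eventually
      (Int.isClosedEmbedding_coe_real.isClosed_range.isOpen_compl.mem_nhds (by simpa only [hzv', mem_compl_iff] using hv))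
  obtain ⟨a, b, hab, hU⟩ := mem_nhds_iff_exists_Ioo_subset.1 hmem
  obtain ⟨w, hzw, hw⟩ := exists_between (lt_min hab.2 hzx')
  rw [lt_min_iff] at hw
  have := hX.image_subsingleton hφ hc hφX isPreconnected_Ioo
    (fun t ht => mem_offOrbit_of_sub_notMem_int (hU ht))
    (mem_image_of_mem φ hab) (mem_image_of_mem φ ⟨hab.1.trans hzw, hw.1⟩)
  have := hgt w ⟨hzw, hw.2.le⟩
  linarith

theorem SeparatesShiftPos.epimorphismRigid {X : Set ℝ} (hX : SeparatesShiftPos X)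
    (hd : Dense X) : EpimorphismRigid X := by
  intro e he x
  obtain ⟨φ, hφ, hφe⟩ := hd.exists_monotone_extension_real e.monotone
  have hφX : MapsTo φ X X := fun y hy => by
    rw [hφe ⟨y, hy⟩]; exact (e _).2
  have hr : X ⊆ range φ := fun y hy => by
    obtain ⟨z, hz⟩ := he ⟨y, hy⟩
    exact ⟨z, by rw [hφe, hz]⟩
  have hc : Continuous φ := hφ.continuous_of_denseRange (hd.mono hr)
  have hanti := hX.antitone_sub hφ hc hφX
  refine Subtype.ext ?_
  rw [← hφe x]
  rcases lt_trichotomy (φ x) x with h | h | h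
  · exfalso
    have hs := hX.image_subsingleton hφ hc hφX (U := Ici (x : ℝ)) isPreconnected_Ici (by
      intro y hy
      have h1 : φ y - y ≤ φ x - x := hanti hy
      rcases le_or_gt y 0 with h0 | h0
      · rw [mem_offOrbit_of_nonpos h0]
        intro h2
        linarith
      · rw [mem_offOrbit_of_pos h0]
        rintro ⟨n, hn⟩
        have : (0 : ℝ) ≤ n := by positivity
        linarith)
    obtain ⟨w, hw, hxw⟩ := hd.exists_gt (φ x)
    obtain ⟨y, rfl⟩ := hr hw
    rcases le_total y x with hyx | hyx
    · exact hxw.not_ge (hφ hyx)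
    · exact hxw.ne (hs (mem_image_of_mem φ self_mem_Ici) (mem_image_of_mem φ hyx))
  · exact h
  · exfalso
    -- Positive displacement alone forces a point off its orbit only on the nonpositive side, hence
    -- the `min` with `0`.
    have hs := hX.image_subsingleton hφ hc hφX (U := Iic (min (x : ℝ) 0)) isPreconnected_Iic (by
      intro y hy
      have hy : y ≤ min (x : ℝ) 0 := hy
      rw [le_min_iff] at hy
      have h1 : φ x - x ≤ φ y - y := hanti hy.1
      rw [mem_offOrbit_of_nonpos hy.2]
      intro h2
      linarith)
    obtain ⟨w, hw, hxw⟩ := hd.exists_lt (φ (min (x : ℝ) 0))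
    obtain ⟨y, rfl⟩ := hr hw
    rcases le_total (min (x : ℝ) 0) y with hyx | hyx
    · exact hxw.not_ge (hφ hyx)
    · exact hxw.ne (hs (mem_image_of_mem φ hyx) (mem_image_of_mem φ self_mem_Ici))

/-! ### Displacement of embeddings and generation in the wide sense. -/

/-- `k` is the least value of `N` beyond `b`. Capping at `b + 1` covers a value that persists, and
every step gains 1 either in position or in value. -/
theorem MonotoneOn.exists_constant_stretch {N : ℝ → ℕ} (hN : MonotoneOn N (Ioi 0)) {b : ℝ}
    (hb : 0 ≤ b) : ∃ (b' : ℝ) (k : ℕ), b < b' ∧ (∀ z ∈ Ioo b b', N z = k) ∧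
      (b' = b + 1 ∨ ∀ z, b' < z → k + 1 ≤ N z) := by
  obtain ⟨z₀, hz₀, hmin⟩ : ∃ z₀ > b, ∀ z > b, N z₀ ≤ N z := by
    obtain ⟨_, ⟨z₀, hz₀, rfl⟩, h⟩ := wellFounded_lt.has_min (N '' Ioi b) ⟨_, b + 1, by simp, rfl⟩
    exact ⟨z₀, hz₀, fun z hz => not_lt.1 (h _ ⟨z, hz, rfl⟩)⟩
  have hT : ∀ t > b, N t = N z₀ → ∀ z, b < z → z ≤ t → N z = N z₀ := fun t ht htN z hz hzt =>
    le_antisymm ((hN (hb.trans_lt hz) (hb.trans_lt ht) hzt).trans htN.le) (hmin z hz)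
  by_cases h : ∃ t ≥ b + 1, N t = N z₀
  · obtain ⟨t, ht, htN⟩ := h
    exact ⟨b + 1, N z₀, by linarith, fun z hz => hT t (by linarith) htN z hz.1
      (hz.2.le.trans ht), Or.inl rfl⟩
  · push Not at h
    let T : Set ℝ := {t | b < t ∧ N t = N z₀}
    have hTb : BddAbove T := ⟨b + 1, fun t ht => by
      by_contra! h'
      exact h t h'.le ht.2⟩
    have hzT : z₀ ∈ T := ⟨hz₀, rfl⟩
    have hbT : b < sSup T := lt_of_lt_of_le hz₀ (le_csSup hTb hzT)
    refine ⟨sSup T, N z₀, hbT, fun z hz => ?_, Or.inr fun z hz => ?_⟩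
    · obtain ⟨t, ht, hzt⟩ := exists_lt_of_lt_csSup ⟨z₀, hzT⟩ hz.2
      exact hT t ht.1 ht.2 z hz.1 hzt.le
    · refine Nat.succ_le_of_lt ((hmin z (hbT.trans hz)).lt_of_ne fun h' => ?_)
      exact hz.not_ge (le_csSup hTb ⟨hbT.trans hz, h'.symm⟩)

/-- By the gain per step, `b i + k i` grows at least like `i`. A bound `B` on the `b i` would bound
the `k i` by `N B`. -/
theorem MonotoneOn.exists_constant_stretches {N : ℝ → ℕ} (hN : MonotoneOn N (Ioi 0)) {b₀ : ℝ}
    (hb₀ : 0 ≤ b₀) : ∃ (b : ℕ → ℝ) (k : ℕ → ℕ), b 0 = b₀ ∧ StrictMono b ∧ Monotone k ∧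
      (∀ i, ∀ z ∈ Ioo (b i) (b (i + 1)), N z = k i) ∧ Tendsto b atTop atTop := by
  choose F K hF hK hFK using fun c : {c : ℝ // 0 ≤ c} => hN.exists_constant_stretch c.2
  let s : ℕ → {c : ℝ // 0 ≤ c} := fun n =>
    (fun c => ⟨F c, c.2.trans (hF c).le⟩)^[n] ⟨b₀, hb₀⟩
  have hs : ∀ i, (s (i + 1) : ℝ) = F (s i) := fun i =>
    congrArg Subtype.val (Function.iterate_succ_apply' _ i _)
  have hmono : StrictMono fun i : ℕ => (s i).1 :=
    strictMono_nat_of_lt_succ (f := fun i : ℕ => (s i).1) fun i => by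
      rw [hs]; exact hF _
  have hconst : ∀ i, ∀ z ∈ Ioo (s i).1 (s (i + 1)), N z = K (s i) := fun i z hz => by
    rw [hs] at hz; exact hK _ z hz
  have hkmono : Monotone fun i : ℕ => K (s i) := monotone_nat_of_le_succ (f := fun i : ℕ => K (s i)) fun i => by
    obtain ⟨z, hz⟩ := exists_between (hmono i.lt_succ_self)
    obtain ⟨w, hw⟩ := exists_between (hmono (i + 1).lt_succ_self)
    have h0 : (0 : ℝ) < z := (s i).2.trans_lt hz.1
    have hzw : z < w := hz.2.trans hw.1
    rw [← hconst i z hz, ← hconst (i + 1) w hw]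
    exact hN h0 (h0.trans hzw) hzw.le
  have hsum : ∀ i : ℕ, b₀ + i ≤ s i + K (s i) := by
    intro i
    induction i with
    | zero => simp [s]
    | succ i ih =>
      have h1 : (K (s i) : ℝ) ≤ K (s (i + 1)) := by exact_mod_cast hkmono i.le_succ
      rcases hFK (s i) with h | h
      · rw [← hs] at h
        push_cast
        linarith
      · rw [← hs] at h
        obtain ⟨w, hw⟩ := exists_between (hmono (i + 1).lt_succ_self)
        have h2 := h w hw.1
        rw [hconst (i + 1) w hw] at h2
        have h2 : (K (s i) : ℝ) + 1 ≤ K (s (i + 1)) := by exact_mod_cast h2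
        have h3 : (s i).1 < s (i + 1) := hmono i.lt_succ_self
        push_cast
        linarith
  refine ⟨fun i => s i, fun i => K (s i), rfl, hmono, hkmono, hconst, ?_⟩
  refine tendsto_atTop_atTop_of_monotone hmono.monotone fun B => ?_
  by_contra! hB
  have hB0 : 0 < B := (s 0).2.trans_lt (hB 0)
  have hkB : ∀ i, K (s i) ≤ N B := fun i => by
    obtain ⟨z, hz⟩ := exists_between (hmono i.lt_succ_self)
    rw [← hconst i z hz]
    exact hN ((s i).2.trans_lt hz.1) hB0 (hz.2.trans (hB _)).le
  obtain ⟨i, hi⟩ := exists_nat_gt (B + N B - b₀)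
  have h1 := hsum i
  have h2 := hB i
  have h3 : (K (s i) : ℝ) ≤ N B := by exact_mod_cast hkB i
  linarith

theorem Monotone.eq_add_const_of_dense {φ : ℝ → ℝ} (hφ : Monotone φ) {C : Set ℝ} (hC : Dense C)
    {a b c : ℝ} (h : ∀ y ∈ C, y ∈ Ioo a b → φ y = y + c) {x : ℝ} (hx : x ∈ Ioo a b) :
    φ x = x + c := by
  refine le_antisymm (le_of_forall_pos_le_add fun ε hε => ?_)
    (le_of_forall_pos_le_add fun ε hε => ?_)
  · obtain ⟨y, hy, hxy, hy'⟩ := hC.exists_between (lt_min hx.2 (lt_add_of_pos_right x hε))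
    rw [lt_min_iff] at hy'
    have h1 := h y hy ⟨hx.1.trans hxy, hy'.1⟩
    have h2 := hφ hxy.le
    linarith
  · obtain ⟨y, hy, hy', hxy⟩ := hC.exists_between (max_lt hx.1 (sub_lt_self x hε))
    rw [max_lt_iff] at hy'
    have h1 := h y hy ⟨hy'.1, hxy.trans hx.2⟩
    have h2 := hφ hxy.le
    linarith

/-- For points of `C` less than 1 apart, a drop of the integral displacement would be at least 1 and
reverse their order. Larger gaps are bridged through intermediate points of `C`. -/
theorem StrictMono.monotoneOn_sub_of_dense {φ : ℝ → ℝ} (hφ : StrictMono φ) {C : Set ℝ}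
    (hC : Dense C) (h : ∀ y ∈ C, 0 < y → ∃ n : ℕ, φ y = y + n) :
    MonotoneOn (fun x => φ x - x) (Ioi 0) := by
  have hbase : ∀ x ∈ C, ∀ y ∈ C, 0 < x → x < y → y - x < 1 → φ x - x ≤ φ y - y := by
    intro x hx y hy h0 hxy h1
    obtain ⟨n, hn⟩ := h x hx h0
    obtain ⟨m, hm⟩ := h y hy (h0.trans hxy)
    have h2 := hφ hxy
    have h3 : (n : ℝ) < m + 1 := by linarith
    have h4 : (n : ℝ) ≤ m := by exact_mod_cast Nat.lt_succ_iff.1 (by exact_mod_cast h3)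
    linarith
  have hstep : ∀ k : ℕ, ∀ x ∈ C, ∀ y ∈ C, 0 < x → x < y → y - x < k + 1 →
      φ x - x ≤ φ y - y := by
    intro k
    induction k with
    | zero => simpa using hbase
    | succ k ih =>
      intro x hx y hy h0 hxy h1
      have hk : (0 : ℝ) ≤ k := by positivity
      push_cast at h1
      obtain ⟨z, hz, hz1, hz2⟩ := hC.exists_between
        (show max x (y - 1) < min y (x + k + 1) by
          rw [max_lt_iff, lt_min_iff, lt_min_iff]
          refine ⟨⟨?_, ?_⟩, ?_, ?_⟩ <;> linarith)
      rw [max_lt_iff] at hz1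
      rw [lt_min_iff] at hz2
      exact (ih x hx z hz h0 hz1.1 (by linarith)).trans
        (hbase z hz y hy (h0.trans hz1.1) hz2.1 (by linarith))
  intro x hx y hy hxy
  have hx : 0 < x := hx
  rcases hxy.eq_or_lt with rfl | hxy
  · exact le_rfl
  refine le_of_forall_pos_le_add fun ε hε => ?_
  obtain ⟨x', hx', h1, h2⟩ := hC.exists_between
    (show x < min (x + ε / 2) ((x + y) / 2) by rw [lt_min_iff]; constructor <;> linarith)
  obtain ⟨y', hy', h3, h4⟩ := hC.exists_between
    (show max (y - ε / 2) ((x + y) / 2) < y by rw [max_lt_iff]; constructor <;> linarith)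
  rw [lt_min_iff] at h2
  rw [max_lt_iff] at h3
  obtain ⟨k, hk⟩ := exists_nat_gt (y' - x')
  have h5 := hstep k x' hx' y' hy' (hx.trans h1) (h2.2.trans h3.2) (by linarith)
  have h6 := hφ h1
  have h7 := hφ h4
  dsimp only
  linarith

theorem EReal.iSup_coe_eq_top_of_tendsto_atTop {u : ℕ → ℝ} (hu : Tendsto u atTop atTop) :
    ⨆ i, ((u i : ℝ) : EReal) = ⊤ := by
  refine EReal.eq_top_iff_forall_lt _ |>.2 fun y => ?_
  obtain ⟨i, hi⟩ := (hu.eventually_gt_atTop y).exists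
  exact lt_of_lt_of_le (EReal.coe_lt_coe_iff.2 hi) (le_iSup (fun i => ((u i : ℝ) : EReal)) i)

theorem le_shiftPos_iterate (x : ℝ) (n : ℕ) : x ≤ shiftPos^[n] x := by
  rcases le_or_gt x 0 with h | h
  · rw [shiftPos_iterate_of_nonpos h]
  · rw [shiftPos_iterate_of_pos h]
    have : (0 : ℝ) ≤ n := by positivity
    linarith

theorem SeparatesShiftPos.generatedInWideSense {X : Set ℝ} (hX : SeparatesShiftPos X)
    (hd : Dense X) (h0X : (0 : ℝ) ∉ X) {g : X → X} (hg : StrictMono g) (hne : ∃ x, g x ≠ x) :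
    GeneratedInWideSense shiftPos g := by
  obtain ⟨φ, hφ', hφg⟩ := hd.exists_monotone_extension_real hg.monotone
  have hφ := hd.strictMono_extension hg hφ' hφg
  have hφX : MapsTo φ X X := fun y hy => by
    rw [hφg ⟨y, hy⟩]; exact (g _).2
  let C : Set ℝ := {x | ContinuousAt φ x ∧ x ≠ 0}
  have hC : Dense C := by
    refine (((hφ'.countable_not_continuousAt).union (countable_singleton 0)).dense_compl ℝ).mono ?_
    intro x hx
    simpa [C, and_comm] using hx
  have hneg : ∀ x < 0, φ x = x := by
    intro x hx
    have := hφ'.eq_add_const_of_dense hC (a := x - 1) (b := 0) (c := 0) (x := x) (fun y hy hy' => by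
      have := hX.notMem_offOrbit hφ hφX hy.1 hy.2
      rw [mem_offOrbit_of_nonpos hy'.2.le, not_not] at this
      simpa using this) ⟨by linarith, hx⟩
    simpa using this
  have hpos : ∀ y ∈ C, 0 < y → ∃ n : ℕ, φ y = y + n := by
    intro y hy hy0
    have := hX.notMem_offOrbit hφ hφX hy.1 hy.2
    rw [mem_offOrbit_of_pos hy0, not_not] at this
    obtain ⟨n, hn⟩ := this
    exact ⟨n, by linarith⟩
  have hmono := hφ.monotoneOn_sub_of_dense hC hpos
  have hnonneg : ∀ x > 0, 0 ≤ φ x - x := by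
    intro x hx
    obtain ⟨y, hy, hy0, hyx⟩ := hC.exists_between hx
    obtain ⟨n, hn⟩ := hpos y hy hy0
    have h1 : φ y - y ≤ φ x - x := hmono hy0 hx hyx.le
    have : (0 : ℝ) ≤ n := by positivity
    linarith
  let N : ℝ → ℕ := fun x => ⌊φ x - x⌋₊
  have hN : MonotoneOn N (Ioi 0) := fun x hx y hy hxy => Nat.floor_mono (hmono hx hy hxy)
  have hstretch : ∀ (a b : ℝ) (k : ℕ), 0 ≤ a → (∀ z ∈ Ioo a b, N z = k) →
      ∀ x ∈ Ioo a b, φ x = x + k := by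
    intro a b k ha hk x hx
    refine hφ'.eq_add_const_of_dense hC (fun y hy hy' => ?_) hx
    obtain ⟨n, hn⟩ := hpos y hy (ha.trans_lt hy'.1)
    have := hk y hy'
    simp only [N, hn, add_sub_cancel_left, Nat.floor_natCast] at this
    rw [hn, this]
  -- `b 0` will be the infimum of `J`, the place where `φ` starts to move points.
  let J : Set ℝ := {x | 0 < x ∧ 1 ≤ N x}
  have hJ : J.Nonempty := by
    by_contra! h
    obtain ⟨x, hx⟩ := hne
    refine hx (Subtype.ext ?_)
    rw [← hφg]
    have hx0 : (x : ℝ) ≠ 0 := fun h => h0X (h ▸ x.2)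
    rcases lt_or_gt_of_ne hx0 with hx0 | hx0
    · exact hneg _ hx0
    · have := hstretch 0 (x + 1) 0 le_rfl (fun z hz => by
        by_contra h1
        have : z ∈ J := ⟨hz.1, Nat.one_le_iff_ne_zero.2 h1⟩
        simp [h] at this) x ⟨hx0, by linarith⟩
      simpa using this
  have hJb : BddBelow J := ⟨0, fun x hx => hx.1.le⟩
  have hb₀ : 0 ≤ sInf J := le_csInf hJ fun x hx => hx.1.le
  obtain ⟨b, k, hb0, hb, hk, hbk, hlim⟩ := hN.exists_constant_stretches hb₀
  have hbpos : ∀ i, 0 < b (i + 1) := fun i =>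
    (hb0 ▸ hb₀ : 0 ≤ b 0).trans_lt (hb i.succ_pos)
  have hbnn : ∀ i, 0 ≤ b i := fun i => (hb0 ▸ hb₀ : 0 ≤ b 0).trans (hb.monotone i.zero_le)
  have hφb : ∀ i, ∀ x ∈ Ioo (b i) (b (i + 1)), φ x = x + k i := fun i =>
    hstretch _ _ _ (hbnn i) (hbk i)
  have hlow : ∀ x < b 0, x ≠ 0 → φ x = x := by
    intro x hx hx0
    rcases lt_or_gt_of_ne hx0 with hx0 | hx0
    · exact hneg _ hx0
    · have := hstretch 0 (b 0) 0 le_rfl (fun z hz => by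
        by_contra h1
        have : z ∈ J := ⟨hz.1, Nat.one_le_iff_ne_zero.2 h1⟩
        exact (csInf_le hJb this).not_gt (hb0 ▸ hz.2)) x ⟨hx0, hx⟩
      simpa using this
  -- At each cut point monotonicity confines `φ` between its one-sided limits, which gives the
  -- bounds on `h`.
  have hright : ∀ i, φ (b i) ≤ b i + k i := by
    intro i
    refine le_of_forall_pos_le_add fun ε hε => ?_
    obtain ⟨z, hz1, hz2⟩ := exists_between (lt_min (hb i.lt_succ_self) (lt_add_of_pos_right _ hε))
    rw [lt_min_iff] at hz2
    have h1 := hφb i z ⟨hz1, hz2.1⟩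
    have h2 := hφ hz1
    linarith
  have hleft : ∀ i, b (i + 1) + k i ≤ φ (b (i + 1)) := by
    intro i
    refine le_of_forall_pos_le_add fun ε hε => ?_
    obtain ⟨z, hz1, hz2⟩ := exists_between (max_lt (hb i.lt_succ_self) (sub_lt_self _ hε))
    rw [max_lt_iff] at hz1
    have h1 := hφb i z ⟨hz1.1, hz2⟩
    have h2 := hφ hz2
    linarith
  -- Only `b 0` can be `0`. Then `h 0` must be `0`, as `shiftPos` fixes `0`, and `g` imposes nothing
  -- because `0 ∉ X`.
  refine ⟨b, k, fun i => if b i = 0 then 0 else φ (b i), hb, ?_, ?_, hk, ?_, ?_, ?_, ?_, ?_, ?_⟩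
  · intro a ha
    have ha0 : 0 < a := (hbnn 0).trans_lt ha.1
    refine ⟨by rw [shiftPos_of_pos ha0]; linarith, fun i => ?_⟩
    obtain ⟨m, hm⟩ := exists_nat_gt (b i)
    exact ⟨m, by rw [shiftPos_iterate_of_pos ha0]; linarith⟩
  · obtain ⟨z, hz⟩ := exists_between (hb Nat.zero_lt_one)
    obtain ⟨x, hx, hxz⟩ := exists_lt_of_csInf_lt hJ (hb0 ▸ hz.1)
    rw [← hbk 0 z hz]
    exact hx.2.trans (hN hx.1 (hx.1.trans hxz) hxz.le)
  · rw [EReal.iSup_coe_eq_top_of_tendsto_atTop hlim, EReal.iSup_coe_eq_top_of_tendsto_atTop]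
    exact tendsto_atTop_mono (fun i => le_shiftPos_iterate _ _) hlim
  · dsimp only
    rcases (hbnn 0).eq_or_lt with h | h
    · rw [if_pos h.symm, ← h, shiftPos_iterate_of_nonpos le_rfl]
      exact ⟨le_rfl, le_rfl⟩
    · rw [if_neg h.ne', shiftPos_iterate_of_pos h]
      exact ⟨by linarith [hnonneg _ h], hright 0⟩
  · intro i
    have h := hbpos i
    dsimp only
    rw [if_neg h.ne', shiftPos_iterate_of_pos h, shiftPos_iterate_of_pos h]
    exact ⟨hleft i, hright _⟩
  · intro x hx
    refine Subtype.ext ?_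
    rw [← hφg]
    refine hlow _ ?_ fun h => h0X (h ▸ x.2)
    by_contra! hx0
    refine hx ?_
    have hex : ∃ i, (x : ℝ) < b i := (hlim.eventually_gt_atTop _).exists
    obtain ⟨i, hi⟩ : ∃ i, Nat.find hex = i + 1 :=
      Nat.exists_eq_succ_of_ne_zero fun h => hx0.not_gt (h ▸ Nat.find_spec hex)
    refine mem_iUnion.2 ⟨i, not_lt.1 (Nat.find_min hex (by omega)), ?_⟩
    exact (hi ▸ Nat.find_spec hex).le
  · intro i x hx
    rw [← hφg, hφb i x hx, shiftPos_iterate_of_pos ((hbnn i).trans_lt hx.1)]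
  · intro i x hx
    have h : b i ≠ 0 := fun h => h0X (by rw [← h, ← hx]; exact x.2)
    rw [← hφg, hx]
    exact (if_neg h).symm

theorem theorem3p1 :
    ∃ X : Set ℝ, Dense X ∧ Cardinal.mk X = 2 ^ Cardinal.aleph0 ∧ EpimorphismRigid X ∧
      ∃ f : X ↪o X, (∀ x : X, (f x : ℝ) = shiftPos x) ∧ (∃ x : X, f x ≠ x) ∧
        ∀ g : X ↪o X, (∃ x : X, g x ≠ x) → GeneratedInWideSense shiftPos g := by
  obtain ⟨X, hd, h0, hf, hc, hX⟩ := exists_shiftPos_diagonal_set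
  have hX : SeparatesShiftPos X := hX
  refine ⟨X, hd, by rw [hc, two_power_aleph0], hX.epimorphismRigid hd,
    OrderEmbedding.ofStrictMono (fun x => ⟨shiftPos x, hf x.2⟩) fun x y h =>
      shiftPos_strictMono h, fun x => rfl, ?_, fun g hg =>
      hX.generatedInWideSense hd h0 g.strictMono hg⟩
  obtain ⟨x, hx, h⟩ := hd.exists_gt 0
  refine ⟨⟨x, hx⟩, fun h' => ?_⟩
  have : shiftPos x = x := congrArg Subtype.val h'
  rw [shiftPos_of_pos h] at this
  linarith
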